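/- Conventions. Let $X$ be a smooth finite-dimensional (Hausdorff, second countable) manifold, $n\ge 1$, and let $\omega\in\Omega^{n+1}(X)$ be closed; $(X,\omega)$ is called a pre-$n$-plectic manifold. Let $\mathfrak g$ be a real Lie algebra, possibly infinite-dimensional, and let $\rho:\mathfrak g\to\mathfrak X(X)$ be an infinitesimal action, i.e. a homomorphism of Lie algebras. The action is *premultisymplectic* if $\mathcal L_{\rho(a)}\omega=0$ for all $a\in\mathfrak g$. A form $\alpha\in\Omega^{n-1}(X)$ is *Hamiltonian* if $\iota_\chi\omega=-d\alpha$ for some vector field $\chi$ (a Hamiltonian vector field of $\alpha$). Let $L_\infty(X,\omega)$ be the $L_\infty$-algebra with degree $0$ part the Hamiltonian $(n-1)$-forms, degree $i$ part $\Omega^{n-1+i}(X)$ for $1-n\le i<0$ and zero otherwise, with brackets $l_1=d$ in negative degrees, $l_k(\alpha_1,\dots,\alpha_k)=-(-1)^{k(k+1)/2}\iota_{\chi_k}\cdots\iota_{\chi_1}\omega$ for $k>1$ and Hamiltonian forms $\alpha_i$ with Hamiltonian vector fields $\chi_i$, and $l_k=0$ in all other cases. A *homotopy momentum map* for a premultisymplectic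 action $\rho$ is a morphism of $L_\infty$-algebras $\mu:\mathfrak g\to L_\infty(X,\omega)$, with components $\mu_i:\wedge^i\mathfrak g\to L_\infty(X,\omega)$ of degree $1-i$, such that $\iota_{\rho(a)}\omega=-d\mu_1(a)$ for all $a\in\mathfrak g$. The action is *Hamiltonian* if it is premultisymplectic and admits a homotopy momentum map. Let $\Omega^{p,q}(\mathfrak g,X)=\mathrm{Hom}_{\mathbb R}(\wedge^p\mathfrak g,\Omega^q(X))$ for $p\ge1$, $q\ge0$, with $d_{\mathfrak g}\alpha=\alpha\circ\delta_{\mathrm{CE}}$ and $d_X\alpha=(-1)^p\,d\circ\alpha$ for $\alpha\in\Omega^{p,q}(\mathfrak g,X)$, where $\delta_{\mathrm{CE}}(a_1\wedge\dots\wedge a_k)=\sum_{i<j}(-1)^{i+j}[a_i,a_j]\wedge a_1\wedge\cdots\widehat{a_i}\cdots\widehat{a_j}\cdots\wedge a_k$. Let $\Omega^N(\mathfrak g,X)=\bigoplus_{p\ge 1,\,p+q=N}\Omega^{p,q}(\mathfrak g,X)$ be the total complex, with differential $\overline d=d_{\mathfrak g}+d_X$. Put $\omega_i(a_1\wedge\dots\wedge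 a_i)=\iota_{\rho(a_i)}\cdots\iota_{\rho(a_1)}\omega$ and $\overline\omega=\sum_{i=1}^{n+1}(-1)^{i-1}\omega_i\in\Omega^{n+1}(\mathfrak g,X)$. Theorem. In this situation: (i) The action $\rho$ is premultisymplectic if and only if $\overline d\,\overline\omega=0$. (ii) The action $\rho$ is Hamiltonian if and only if $\overline\omega$ is $\overline d$-exact, i.e. $\overline\omega=\overline d\nu$ for some $\nu\in\Omega^n(\mathfrak g,X)$. Moreover, for every $\nu=\sum_{i=1}^n\nu^{(i,n-i)}\in\Omega^n(\mathfrak g,X)$ with $\nu^{(i,n-i)}\in\Omega^{i,n-i}(\mathfrak g,X)$ and $\overline d\nu=\overline\omega$, the maps $\mu_i=-(-1)^{i(i+1)/2}\,\nu^{(i,n-i)}$, $1\le i\le n$, are the components of a homotopy momentum map for $\rho$. -/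

import Mathlib

open scoped Manifold ContDiff

noncomputable section

namespace Multisymp

/-! ### Chevalley–Eilenberg differential with trivial coefficients -/

section ChevalleyEilenberg

variable {𝔤 : Type*} [LieRing 𝔤] [LieAlgebra ℝ 𝔤] {V : Type*} [AddCommGroup V] [Module ℝ V]

/-- Auxiliary bilinear map `(a, b) ↦ α (⁅a, b⁆, …)`; only used to check that `ceDiff` is alternating. -/
def bracketInsert {k : ℕ} (α : 𝔤 [⋀^Fin (k + 1)]→ₗ[ℝ] V) :
    𝔤 →ₗ[ℝ] 𝔤 →ₗ[ℝ] 𝔤 [⋀^Fin k]→ₗ[ℝ] V :=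
  LinearMap.mk₂ ℝ (fun a b => α.curryLeft ⁅a, b⁆)
    (fun a a' b => by rw [add_lie, map_add]) (fun c a b => by rw [smul_lie, map_smul])
    (fun a b b' => by rw [lie_add, map_add]) (fun c a b => by rw [lie_smul, map_smul])

/-- The value of `α ∘ δ_CE` on `v_0 ∧ … ∧ v_k`, where
`δ_CE (v_0 ∧ … ∧ v_k) = ∑_{i < j} (-1)^{i + j} ⁅v_i, v_j⁆ ∧ v_0 ∧ ‥ v̂_i ‥ v̂_j ‥ ∧ v_k`.
The pair `i < j` is encoded by `i.castSucc < j.succ` with `i ≤ j`, whence the overall minus sign. -/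
def ceDiffFun : {k : ℕ} → (𝔤 [⋀^Fin k]→ₗ[ℝ] V) → (Fin (k + 1) → 𝔤) → V
  | 0, _, _ => 0
  | k + 1, α, v =>
      -∑ i : Fin (k + 1), ∑ j ∈ Finset.Ici i, (-1 : ℤ) ^ ((i : ℕ) + (j : ℕ)) •
        α (Matrix.vecCons ⁅v i.castSucc, v j.succ⁆ (j.removeNth (i.castSucc.removeNth v)))

theorem exists_ceDiff {k : ℕ} (α : 𝔤 [⋀^Fin k]→ₗ[ℝ] V) :
    ∃ β : 𝔤 [⋀^Fin (k + 1)]→ₗ[ℝ] V, ⇑β = ceDiffFun α := by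
  cases k with
  | zero => exact ⟨0, rfl⟩
  | succ k =>
    refine ⟨-((1 / 2 : ℝ) • AlternatingMap.alternatizeUncurryFin
      (AlternatingMap.alternatizeUncurryFinLM ∘ₗ bracketInsert α)), ?_⟩
    funext v
    rw [AlternatingMap.neg_apply, AlternatingMap.smul_apply,
      AlternatingMap.alternatizeUncurryFin_alternatizeUncurryFinLM_comp_apply, ceDiffFun,
      Finset.smul_sum]
    congr 1
    refine Finset.sum_congr rfl fun i _ => ?_
    rw [Finset.smul_sum]
    refine Finset.sum_congr rfl fun j _ => ?_
    simp only [bracketInsert, LinearMap.mk₂_apply, AlternatingMap.curryLeft_apply_apply]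
    rw [smul_comm]
    congr 1
    have h : ⁅v j.succ, v i.castSucc⁆ = (-1 : ℝ) • ⁅v i.castSucc, v j.succ⁆ := by
      rw [neg_one_smul, lie_skew]
    rw [h, AlternatingMap.map_vecCons_smul, neg_one_smul, sub_neg_eq_add, ← two_smul ℝ, smul_smul]
    norm_num

/-- `α ↦ α ∘ δ_CE`, from `Hom(Λ^k 𝔤, V)` to `Hom(Λ^{k+1} 𝔤, V)`. -/
def ceDiff {k : ℕ} (α : 𝔤 [⋀^Fin k]→ₗ[ℝ] V) : 𝔤 [⋀^Fin (k + 1)]→ₗ[ℝ] V where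
  toFun := ceDiffFun α
  map_update_add' v i x y := by
    obtain ⟨β, hβ⟩ := exists_ceDiff α
    rw [← hβ]; exact β.map_update_add' v i x y
  map_update_smul' v i c x := by
    obtain ⟨β, hβ⟩ := exists_ceDiff α
    rw [← hβ]; exact β.map_update_smul' v i c x
  map_eq_zero_of_eq' v i j h hij := by
    obtain ⟨β, hβ⟩ := exists_ceDiff α
    rw [← hβ]; exact β.map_eq_zero_of_eq' v i j h hij

end ChevalleyEilenberg

/-! ### Vector fields and differential forms

`A` is a commutative real algebra; for a manifold `X` it is `A = C^∞(X)`.  Vector fields on `X` are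
the derivations of `C^∞(X)`, with the commutator bracket, and `q`-forms on `X` are the alternating
`C^∞(X)`-multilinear maps `𝔛(X)^q → C^∞(X)`. -/

section Forms

variable (A : Type*) [CommRing A] [Algebra ℝ A]

/-- Vector fields `𝔛(X) = Der(C^∞(X))`. -/
abbrev VF := Derivation ℝ A A

/-- Differential `q`-forms. -/
abbrev Form (q : ℕ) := VF A [⋀^Fin q]→ₗ[A] A

variable {A}

/-- A form, regarded as an `ℝ`-multilinear alternating map. -/
def Form.toReal {q : ℕ} (α : Form A q) : VF A [⋀^Fin q]→ₗ[ℝ] A where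
  toFun := α
  map_update_add' := α.map_update_add'
  map_update_smul' v i c x := by
    have h : c • x = (algebraMap ℝ A c) • x := (algebraMap_smul A c x).symm
    rw [h, Algebra.smul_def]
    exact α.map_update_smul v i _ x
  map_eq_zero_of_eq' := α.map_eq_zero_of_eq'

/-- The de Rham differential, evaluated on vector fields:
`dα(v_0, …, v_q) = ∑_i (-1)^i v_i(α(‥ v̂_i ‥)) + ∑_{i<j} (-1)^{i+j} α([v_i, v_j], ‥ v̂_i ‥ v̂_j ‥)`. -/
def extDFun {q : ℕ} (α : Form A q) (v : Fin (q + 1) → VF A) : A :=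
  (∑ i : Fin (q + 1), (-1 : ℤ) ^ (i : ℕ) • v i (α (i.removeNth v))) + ceDiff α.toReal v

/-- The `ℝ`-linear map `v ↦ v ∘ α`; only used to check that `extD` is alternating. -/
def derivComp {q : ℕ} (α : Form A q) : VF A →ₗ[ℝ] VF A [⋀^Fin q]→ₗ[ℝ] A where
  toFun v := (v : A →ₗ[ℝ] A).compAlternatingMap α.toReal
  map_add' v w := by ext x; simp
  map_smul' c v := by ext x; simp

theorem extDFun_eq {q : ℕ} (α : Form A q) : extDFun α =
    ⇑(AlternatingMap.alternatizeUncurryFin (derivComp α) + ceDiff α.toReal) := by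
  funext v
  rw [AlternatingMap.add_apply, AlternatingMap.alternatizeUncurryFin_apply]
  rfl

theorem extDFun_cons_smul {q : ℕ} (α : Form A q) (f : A) (x : VF A) (w : Fin q → VF A) :
    extDFun α (Matrix.vecCons (f • x) w) = f • extDFun α (Matrix.vecCons x w) := by
  have hrem (r : ℕ) (y : VF A) (u : Fin (r + 1) → VF A) (i : Fin (r + 1)) :
      i.succ.removeNth (Matrix.vecCons y u : Fin (r + 2) → VF A) =
        Matrix.vecCons y (i.removeNth u) := by
    funext k
    cases k using Fin.cases <;> simp [Fin.removeNth_apply]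
  have hrem0 (r : ℕ) (y : VF A) (u : Fin r → VF A) :
      (0 : Fin (r + 1)).removeNth (Matrix.vecCons y u : Fin (r + 1) → VF A) = u := rfl
  cases q with
  | zero => simp [extDFun, ceDiff, ceDiffFun, hrem0]
  | succ q =>
    have hlie (y : VF A) : ⁅f • x, y⁆ = f • ⁅x, y⁆ + (-(y f)) • x := by
      ext a
      simp [Derivation.commutator_apply, Derivation.leibniz]
      ring
    have hinner (i : Fin q) (j : Fin (q + 1)) (hj : i.succ ≤ j) (b : VF A) :
        α (Matrix.vecCons b (j.removeNth (i.succ.castSucc.removeNth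
          (Matrix.vecCons (f • x) w : Fin (q + 2) → VF A)))) =
        f * α (Matrix.vecCons b (j.removeNth (i.succ.castSucc.removeNth
          (Matrix.vecCons x w : Fin (q + 2) → VF A)))) := by
      cases q with
      | zero => exact i.elim0
      | succ r =>
        obtain ⟨j, rfl⟩ := Fin.exists_succ_eq.2 (Fin.pos_iff_ne_zero.1
          (lt_of_lt_of_le (Fin.succ_pos i) hj))
        rw [Fin.castSucc_succ, hrem, hrem, hrem, hrem]
        exact AlternatingMap.map_vecCons_smul (α.curryLeft b) _ f x
    have hce (y : VF A) : extDFun α (Matrix.vecCons y w) = y (α w)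
        + (∑ i : Fin (q + 1), (-1 : ℤ) ^ ((i : ℕ) + 1) •
            w i (α (Matrix.vecCons y (i.removeNth w))))
        - ((∑ j : Fin (q + 1), (-1 : ℤ) ^ (j : ℕ) •
            α (Matrix.vecCons ⁅y, w j⁆ (j.removeNth w))) +
          ∑ i : Fin q, ∑ j ∈ Finset.Ici i.succ, (-1 : ℤ) ^ ((i.succ : ℕ) + (j : ℕ)) •
            α (Matrix.vecCons ⁅w i.castSucc, w j⁆ (j.removeNth (i.succ.castSucc.removeNth
          (Matrix.vecCons y w : Fin (q + 2) → VF A))))) := by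
      rw [extDFun, Fin.sum_univ_succ, sub_eq_add_neg]
      congr 1
      · simp only [hrem, hrem0]
        simp
      · change -_ = -_
        rw [Fin.sum_univ_succ]
        have h0 : Finset.Ici (0 : Fin (q + 1)) = Finset.univ := by ext; simp
        rw [h0]
        simp only [Fin.castSucc_zero, hrem0, Fin.val_zero, zero_add]
        rfl
    have h2 : ∑ i : Fin q, ∑ j ∈ Finset.Ici i.succ, (-1 : ℤ) ^ ((i.succ : ℕ) + (j : ℕ)) •
            α (Matrix.vecCons ⁅w i.castSucc, w j⁆ (j.removeNth (i.succ.castSucc.removeNth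
          (Matrix.vecCons (f • x) w : Fin (q + 2) → VF A)))) =
        f * ∑ i : Fin q, ∑ j ∈ Finset.Ici i.succ, (-1 : ℤ) ^ ((i.succ : ℕ) + (j : ℕ)) •
            α (Matrix.vecCons ⁅w i.castSucc, w j⁆ (j.removeNth (i.succ.castSucc.removeNth
          (Matrix.vecCons x w : Fin (q + 2) → VF A)))) := by
      simp only [Finset.mul_sum]
      refine Finset.sum_congr rfl fun i _ => Finset.sum_congr rfl fun j hj => ?_
      rw [hinner i j (Finset.mem_Ici.1 hj), mul_smul_comm]
    rw [hce, hce, h2]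
    have h1 : ∑ i : Fin (q + 1), (-1 : ℤ) ^ ((i : ℕ) + 1) •
            w i (α (Matrix.vecCons (f • x) (i.removeNth w))) -
          ∑ j : Fin (q + 1), (-1 : ℤ) ^ (j : ℕ) •
            α (Matrix.vecCons ⁅f • x, w j⁆ (j.removeNth w)) =
        f * (∑ i : Fin (q + 1), (-1 : ℤ) ^ ((i : ℕ) + 1) •
            w i (α (Matrix.vecCons x (i.removeNth w))) -
          ∑ j : Fin (q + 1), (-1 : ℤ) ^ (j : ℕ) •
            α (Matrix.vecCons ⁅x, w j⁆ (j.removeNth w))) := by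
      rw [← Finset.sum_sub_distrib, ← Finset.sum_sub_distrib, Finset.mul_sum]
      refine Finset.sum_congr rfl fun i _ => ?_
      rw [hlie, AlternatingMap.map_vecCons_add, AlternatingMap.map_vecCons_smul,
        AlternatingMap.map_vecCons_smul, AlternatingMap.map_vecCons_smul]
      simp only [smul_eq_mul, Derivation.leibniz, zsmul_eq_mul, pow_succ]
      push_cast
      ring
    have h3 : (f • x) (α w) = f * x (α w) := rfl
    rw [h3, smul_eq_mul]
    linear_combination h1

theorem extDFun_update_smul {q : ℕ} (α : Form A q) (v : Fin (q + 1) → VF A) (i : Fin (q + 1))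
    (f : A) (x : VF A) :
    extDFun α (Function.update v i (f • x)) = f • extDFun α (Function.update v i x) := by
  have key (y : VF A) : extDFun α (Function.update v i y) =
      (-1 : ℤ) ^ (i : ℕ) • extDFun α (Matrix.vecCons y (i.removeNth v)) := by
    rw [← Fin.insertNth_removeNth, extDFun_eq, AlternatingMap.map_insertNth]
  rw [key, key, extDFun_cons_smul, smul_comm]

/-- The de Rham differential `d : Ω^q → Ω^{q+1}`. -/
def extD {q : ℕ} : Form A q →ₗ[ℝ] Form A (q + 1) where
  toFun α :=
    { toFun := extDFun α
      map_update_add' := fun {inst} v i x y => by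
        rw [extDFun_eq]; exact AlternatingMap.map_update_add _ v i x y
      map_update_smul' := fun {inst} v i f x => by
        rw [Subsingleton.elim inst (instDecidableEqFin _)]
        exact extDFun_update_smul α v i f x
      map_eq_zero_of_eq' := fun v i j h hij => by
        rw [extDFun_eq]; exact AlternatingMap.map_eq_zero_of_eq _ v h hij }
  map_add' α β := by
    ext v
    change extDFun (α + β) v = extDFun α v + extDFun β v
    have h : derivComp (α + β) = derivComp α + derivComp β := by
      ext x u; exact map_add x (α u) (β u)
    have h' : ceDiff (α + β).toReal v = ceDiff α.toReal v + ceDiff β.toReal v := by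
      cases q with
      | zero => exact (add_zero _).symm
      | succ q =>
        change -_ = -_ + -_
        simp only [← neg_add, ← Finset.sum_add_distrib, ← smul_add]
        rfl
    rw [extDFun_eq, extDFun_eq, extDFun_eq, h, AlternatingMap.alternatizeUncurryFin_add]
    simp only [AlternatingMap.add_apply, h']
    abel
  map_smul' c α := by
    ext v
    change extDFun (c • α) v = c • extDFun α v
    have h : derivComp (c • α) = c • derivComp α := by
      ext x u; exact x.map_smul c (α u)
    have h' : ceDiff (c • α).toReal v = c • ceDiff α.toReal v := by
      cases q with
      | zero => exact (smul_zero _).symm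
      | succ q =>
        change -_ = c • -_
        simp only [smul_neg, Finset.smul_sum]
        congr 1
        refine Finset.sum_congr rfl fun i _ => Finset.sum_congr rfl fun j _ => ?_
        rw [smul_comm c]
        rfl
    rw [extDFun_eq, extDFun_eq, h, AlternatingMap.alternatizeUncurryFin_smul]
    simp only [AlternatingMap.add_apply, AlternatingMap.smul_apply, h', smul_add]

/-- The Lie derivative, evaluated on vector fields:
`(L_v α)(w_1, …, w_q) = v(α(w_1, …, w_q)) - ∑_j α(w_1, …, [v, w_j], …, w_q)`. -/
def lieDerivFun {q : ℕ} (v : VF A) (α : Form A q) (w : Fin q → VF A) : A :=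
  v (α w) - ∑ j : Fin q, α (Function.update w j ⁅v, w j⁆)

theorem lieDerivFun_update {q : ℕ} (v : VF A) (α : Form A q) (w : Fin q → VF A) (i : Fin q)
    (x : VF A) : lieDerivFun v α (Function.update w i x) =
      v (α (Function.update w i x)) - α (Function.update w i ⁅v, x⁆) -
        ∑ j ∈ Finset.univ.erase i,
          α (Function.update (Function.update w j ⁅v, w j⁆) i x) := by
  rw [lieDerivFun, ← Finset.add_sum_erase _ _ (Finset.mem_univ i), ← sub_sub]
  congr 1
  · simp
  · refine Finset.sum_congr rfl fun j hj => ?_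
    have hji : j ≠ i := Finset.ne_of_mem_erase hj
    rw [Function.update_of_ne hji, Function.update_comm hji]

/-- The Lie derivative `L_v : Ω^q → Ω^q`. -/
def lieDeriv {q : ℕ} (v : VF A) (α : Form A q) : Form A q where
  toFun := lieDerivFun v α
  map_update_add' := fun {inst} w i x y => by
    rw [Subsingleton.elim inst (instDecidableEqFin _)]
    simp only [lieDerivFun_update, AlternatingMap.map_update_add, lie_add, map_add,
      Finset.sum_add_distrib]
    abel
  map_update_smul' := fun {inst} w i f x => by
    rw [Subsingleton.elim inst (instDecidableEqFin _)]
    have hlie : ⁅v, f • x⁆ = f • ⁅v, x⁆ + (v f) • x := by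
      ext a
      simp [Derivation.commutator_apply]
    simp only [lieDerivFun_update, AlternatingMap.map_update_add, AlternatingMap.map_update_smul,
      hlie, smul_eq_mul, Derivation.leibniz, ← Finset.mul_sum]
    ring
  map_eq_zero_of_eq' := fun w i j h hij => by
    have hz : ∀ k, k ≠ i → k ≠ j → α (Function.update w k ⁅v, w k⁆) = 0 := fun k hi hj =>
      α.map_eq_zero_of_eq _ (by
        rw [Function.update_of_ne hi.symm, Function.update_of_ne hj.symm, h]) hij
    have hs : ∑ k : Fin q, α (Function.update w k ⁅v, w k⁆) =
        α (Function.update w i ⁅v, w i⁆) + α (Function.update w j ⁅v, w j⁆) :=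
      Fintype.sum_eq_add i j hij fun k hk => hz k hk.1 hk.2
    have hswap : Function.update w j ⁅v, w j⁆ =
        Function.update w i ⁅v, w i⁆ ∘ Equiv.swap i j := by
      funext k
      by_cases hki : k = i
      · subst hki
        simp [hij, h, hij.symm]
      · by_cases hkj : k = j
        · subst hkj
          simp [h]
        · simp [hki, hkj, Equiv.swap_apply_of_ne_of_ne]
    rw [lieDerivFun, hs, hswap, α.map_swap _ hij, α.map_eq_zero_of_eq w h hij]
    simp

/-! ### The graded vector space of all forms -/

variable (A) in
/-- `Ω^•(X)`: a form for every degree.  Homogeneous elements have a single nonzero component. -/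
abbrev Omega := ∀ q : ℕ, Form A q

variable (A) in
/-- The inclusion `Ω^q(X) → Ω^•(X)`. -/
def incl (q : ℕ) : Form A q →ₗ[ℝ] Omega A := LinearMap.single ℝ (Form A) q

/-- The de Rham differential on `Ω^•(X)`. -/
def dTot : Omega A →ₗ[ℝ] Omega A where
  toFun α
    | 0 => 0
    | q + 1 => extD (α q)
  map_add' α β := by
    funext q
    cases q with
    | zero => exact (add_zero _).symm
    | succ q => exact map_add extD (α q) (β q)
  map_smul' c α := by
    funext q
    cases q with
    | zero => exact (smul_zero c).symm
    | succ q => exact map_smul extD c (α q)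

/-- The interior product `ι_v` on `Ω^•(X)`: `(ι_v α)(w_1, …, w_q) = α(v, w_1, …, w_q)`. -/
def iota (v : VF A) (α : Omega A) : Omega A := fun q => (α (q + 1)).curryLeft v

/-- The iterated interior product `ι_{χ_k} ⋯ ι_{χ_1} α`. -/
def iotaIter : {k : ℕ} → (Fin k → VF A) → Omega A → Omega A
  | 0, _, α => α
  | _ + 1, χ, α => iotaIter (Fin.tail χ) (iota (χ 0) α)

/-- Auxiliary concatenation `(χ_1, …, χ_k, w_1, …, w_q)`. -/
def cat {k q : ℕ} (χ : Fin k → VF A) (w : Fin q → VF A) : Fin (q + k) → VF A :=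
  fun m => if h : (m : ℕ) < k then χ ⟨m, h⟩ else w ⟨m - k, by omega⟩

theorem iotaIter_apply {k : ℕ} (χ : Fin k → VF A) (α : Omega A) (q : ℕ) (w : Fin q → VF A) :
    iotaIter χ α q w = α (q + k) (cat χ w) := by
  induction k generalizing α with
  | zero => rfl
  | succ k ih =>
    rw [iotaIter, ih]
    have h : (Matrix.vecCons (χ 0) (cat (Fin.tail χ) w) : Fin (q + k + 1) → VF A) =
        (cat χ w : Fin (q + (k + 1)) → VF A) := by
      funext m
      cases m using Fin.cases with
      | zero => simp [cat]
      | succ m => simp [cat, Fin.tail]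
    exact congrArg (α (q + k + 1)) h

theorem cat_update {k q : ℕ} (χ : Fin k → VF A) (w : Fin q → VF A) (i : Fin k) (x : VF A) :
    cat (Function.update χ i x) w =
      Function.update (cat χ w) ⟨i, by omega⟩ x := by
  funext m
  by_cases hm : m = ⟨i, by omega⟩
  · subst hm
    simp [cat]
  · rw [Function.update_of_ne hm]
    unfold cat
    split_ifs with h
    · rw [Function.update_of_ne]
      intro h'
      exact hm (Fin.ext (Fin.ext_iff.1 h' :))
    · rfl

end Forms

section Action

variable {A : Type*} [CommRing A] [Algebra ℝ A]
variable {𝔤 : Type*} [LieRing 𝔤] [LieAlgebra ℝ 𝔤]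

/-- For `β ∈ Ω^•(X)`, the element `a_1 ∧ ⋯ ∧ a_p ↦ ι_{ρ(a_p)} ⋯ ι_{ρ(a_1)} β` of
`Hom(Λ^p 𝔤, Ω^q(X))`; it sees the component of `β` of degree `p + q`. -/
def contraction (ρ : 𝔤 →ₗ⁅ℝ⁆ VF A) (β : Omega A) (p q : ℕ) : 𝔤 [⋀^Fin p]→ₗ[ℝ] Form A q where
  toFun a := iotaIter (fun j => ρ (a j)) β q
  map_update_add' := fun {inst} a i x y => by
    obtain rfl : inst = instDecidableEqFin _ := Subsingleton.elim _ _
    have h (z : 𝔤) : (fun j => ρ (Function.update a i z j)) =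
        Function.update (fun j => ρ (a j)) i (ρ z) := by
      funext j; exact Function.apply_update (fun _ => ρ) a i z j
    ext w
    rw [AlternatingMap.add_apply]
    simp only [iotaIter_apply, h, cat_update, map_add, AlternatingMap.map_update_add]
  map_update_smul' := fun {inst} a i c x => by
    obtain rfl : inst = instDecidableEqFin _ := Subsingleton.elim _ _
    have h (z : 𝔤) : (fun j => ρ (Function.update a i z j)) =
        Function.update (fun j => ρ (a j)) i (ρ z) := by
      funext j; exact Function.apply_update (fun _ => ρ) a i z j
    ext w
    rw [AlternatingMap.smul_apply]
    simp only [iotaIter_apply, h, cat_update, map_smul]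
    exact (β (q + p)).toReal.map_update_smul _ _ c _
  map_eq_zero_of_eq' := fun a i j h hij => by
    ext w
    rw [iotaIter_apply]
    refine (β (q + p)).map_eq_zero_of_eq _ (i := ⟨i, by omega⟩) (j := ⟨j, by omega⟩) ?_ ?_
    · simp [cat, h]
    · intro h'
      exact hij (Fin.ext (Fin.ext_iff.1 h' :))

/-! ### The double complex `Ω^{p,q}(𝔤, X) = Hom(Λ^p 𝔤, Ω^q(X))` -/

variable (𝔤 A) in
/-- Families of elements of `Hom(Λ^p 𝔤, Ω^q(X))`, for all `p` and `q`. -/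
abbrev BiForm := ∀ p q : ℕ, 𝔤 [⋀^Fin p]→ₗ[ℝ] Form A q

variable (𝔤 A) in
/-- `Ω^N(𝔤, X) = ⨁_{p ≥ 1, q ≥ 0, p + q = N} Ω^{p,q}(𝔤, X)`. -/
def totalDegree (N : ℕ) : Submodule ℝ (BiForm A 𝔤) where
  carrier := {α | ∀ p q, ¬ (1 ≤ p ∧ p + q = N) → α p q = 0}
  add_mem' {α β} hα hβ p q h := by
    change α p q + β p q = 0
    rw [hα p q h, hβ p q h, add_zero]
  zero_mem' p q _ := rfl
  smul_mem' c α hα p q h := by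
    change c • α p q = 0
    rw [hα p q h, smul_zero]

/-- `d_𝔤 α = α ∘ δ_CE`. -/
def dLie (α : BiForm A 𝔤) : BiForm A 𝔤
  | 0, _ => 0
  | p + 1, q => ceDiff (α p q)

/-- `d_X α = (-1)^p d ∘ α` on `Ω^{p,•}(𝔤, X)`. -/
def dX (α : BiForm A 𝔤) : BiForm A 𝔤
  | _, 0 => 0
  | p, q + 1 => (-1 : ℝ) ^ p • extD.compAlternatingMap (α p q)

/-- The differential `d_𝔤 + d_X` of the total complex. -/
def dBar (α : BiForm A 𝔤) : BiForm A 𝔤 := dLie α + dX α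

/-- `β̄ = ∑_{i ≥ 1} (-1)^{i-1} β_i`, where `β_i` is the contraction of `β` with `i` generators. -/
def bar (ρ : 𝔤 →ₗ⁅ℝ⁆ VF A) {m : ℕ} (β : Form A m) : BiForm A 𝔤 := fun p q =>
  if 1 ≤ p then (-1 : ℝ) ^ (p - 1) • contraction ρ (incl A m β) p q else 0

theorem bar_mem_totalDegree (ρ : 𝔤 →ₗ⁅ℝ⁆ VF A) {m : ℕ} (β : Form A m) :
    bar ρ β ∈ totalDegree A 𝔤 m := by
  intro p q h
  by_cases hp : 1 ≤ p
  · have hm : q + p ≠ m := fun h' => h ⟨hp, by omega⟩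
    have h0 : contraction ρ (incl A m β) p q = 0 := by
      ext a w
      change iotaIter (fun j => ρ (a j)) (incl A m β) q w = 0
      rw [iotaIter_apply]
      have : incl A m β (q + p) = 0 := Pi.single_eq_of_ne hm β
      rw [this]; rfl
    rw [bar, if_pos hp, h0, smul_zero]
  · rw [bar, if_neg hp]

/-! ### `L_∞`-algebras and morphisms out of a Lie algebra -/

/-- A `ℤ`-grading and multibrackets on a vector space.  The brackets are only meaningful on
homogeneous elements. -/
structure GradedBrackets (L : Type*) [AddCommGroup L] [Module ℝ L] where
  /-- The homogeneous part of a given degree. -/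
  part : ℤ → Submodule ℝ L
  /-- The multibracket `l_k`. -/
  bracket : (k : ℕ) → (Fin k → L) → L

/-- `L_∞`-morphisms from a Lie algebra `𝔤` (in degree `0`, with its Lie bracket as the only bracket)
to a graded vector space with multibrackets `l_k` of degree `2 - k`: skew-symmetric multilinear maps
`f_i : Λ^i 𝔤 → L` of degree `1 - i`, for `i ≥ 1`, such that for all `m ≥ 1`
`∑_{i<j} (-1)^{i+j+1} f_{m-1}([a_i, a_j], ‥ â_i ‥ â_j ‥) =`
`∑_k ∑_{c_1 + ⋯ + c_k = m} ± 1 / (k! c_1! ⋯ c_k!) ∑_σ sgn(σ) l_k(f_{c_1}(a_{σ(1)}, …), …, f_{c_k}(…, a_{σ(m)}))`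
with sign `(-1)^{∑_j (k - j) (c_j - 1)}`, the Koszul sign of the arguments `f_{c_j}(…)`. -/
structure IsLInftyMorphism {L : Type*} [AddCommGroup L] [Module ℝ L] (B : GradedBrackets L)
    (f : ∀ i : ℕ, 𝔤 [⋀^Fin i]→ₗ[ℝ] L) : Prop where
  zero : f 0 = 0
  degree : ∀ i : ℕ, 1 ≤ i → ∀ a, f i a ∈ B.part (1 - (i : ℤ))
  relation : ∀ (r : ℕ) (a : Fin (r + 1) → 𝔤),
    -ceDiff (f r) a = ∑ c : Composition (r + 1),
      ((-1 : ℝ) ^ (∑ j : Fin c.length, (c.length - 1 - (j : ℕ)) * (c.blocksFun j - 1)) /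
        ((c.length.factorial : ℝ) * ∏ j, ((c.blocksFun j).factorial : ℝ))) •
      ∑ σ : Equiv.Perm (Fin (r + 1)), (Equiv.Perm.sign σ : ℤ) •
        B.bracket c.length (fun j => f (c.blocksFun j) (fun t => a (σ (c.embedding j t))))

/-! ### Premultisymplectic geometry -/

/-- `χ` is a Hamiltonian vector field of `α`: `ι_χ ω = -dα`. -/
def IsHamVF {n : ℕ} (ω₀ : Form A (n + 1)) (α : Omega A) (χ : VF A) : Prop :=
  iota χ (incl A (n + 1) ω₀) = -dTot α

open Classical in
/-- A choice of Hamiltonian vector field, if there is one. -/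
def hamVF {n : ℕ} (ω₀ : Form A (n + 1)) (α : Omega A) : VF A :=
  if h : ∃ χ, IsHamVF ω₀ α χ then h.choose else 0

/-- The degree `i` part of `L_∞(X, ω)`: Hamiltonian `(n-1)`-forms for `i = 0`, all forms of degree
`n - 1 + i` for `1 - n ≤ i < 0`, and zero otherwise. -/
def LInftyPart {n : ℕ} (ω₀ : Form A (n + 1)) (i : ℤ) : Submodule ℝ (Omega A) where
  carrier := {α | (∀ q : ℕ, ¬ (i ≤ 0 ∧ (q : ℤ) = n - 1 + i) → α q = 0) ∧
    (i = 0 → ∃ χ, IsHamVF ω₀ α χ)}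
  add_mem' {α β} hα hβ := by
    refine ⟨fun q h => ?_, fun h => ?_⟩
    · change α q + β q = 0
      rw [hα.1 q h, hβ.1 q h, add_zero]
    · obtain ⟨χ, hχ⟩ := hα.2 h
      obtain ⟨ξ, hξ⟩ := hβ.2 h
      refine ⟨χ + ξ, ?_⟩
      unfold IsHamVF at *
      rw [map_add, neg_add, ← hχ, ← hξ]
      funext q
      exact map_add _ χ ξ
  zero_mem' := by
    refine ⟨fun q _ => rfl, fun _ => ⟨0, ?_⟩⟩
    unfold IsHamVF
    rw [map_zero, neg_zero]
    funext q
    exact map_zero _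
  smul_mem' c α hα := by
    refine ⟨fun q h => ?_, fun h => ?_⟩
    · change c • α q = 0
      rw [hα.1 q h, smul_zero]
    · obtain ⟨χ, hχ⟩ := hα.2 h
      refine ⟨c • χ, ?_⟩
      unfold IsHamVF at *
      have h2 : iota (c • χ) (incl A (n + 1) ω₀) = c • iota χ (incl A (n + 1) ω₀) := by
        funext q
        ext w
        exact AlternatingMap.map_vecCons_smul (incl A (n + 1) ω₀ (q + 1)).toReal w c χ
      rw [h2, hχ, map_smul]
      exact smul_neg c _

open Classical in
/-- The multibrackets of `L_∞(X, ω)`: `l_1 = d` in negative degrees (that is, on `q`-forms with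
`q < n - 1`), `l_k(α_1, …, α_k) = -(-1)^{k(k+1)/2} ι_{χ_k} ⋯ ι_{χ_1} ω` for `k > 1` and Hamiltonian
forms `α_i` with Hamiltonian vector fields `χ_i`, and `l_k = 0` in all other cases. -/
def LInftyBracket {n : ℕ} (ω₀ : Form A (n + 1)) : (k : ℕ) → (Fin k → Omega A) → Omega A
  | 0, _ => 0
  | 1, α => dTot (fun q => if q + 1 < n then α 0 q else 0)
  | k + 2, α =>
      if ∀ j, α j ∈ LInftyPart ω₀ 0 then
        (-(-1 : ℝ) ^ ((k + 2) * (k + 3) / 2)) •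
          iotaIter (fun j => hamVF ω₀ (α j)) (incl A (n + 1) ω₀)
      else 0

/-- The `L_∞`-algebra `L_∞(X, ω)` of Hamiltonian forms. -/
def LInfty {n : ℕ} (ω₀ : Form A (n + 1)) : GradedBrackets (Omega A) where
  part := LInftyPart ω₀
  bracket := LInftyBracket ω₀

/-- The infinitesimal action `ρ` leaves `ω` invariant. -/
def IsPremultisymplectic {m : ℕ} (ω₀ : Form A m) (ρ : 𝔤 →ₗ⁅ℝ⁆ VF A) : Prop :=
  ∀ a, lieDeriv (ρ a) ω₀ = 0

/-- `μ` consists of the components `μ_i : Λ^i 𝔤 → L_∞(X, ω)` of a homotopy momentum map for the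
premultisymplectic action `ρ`: an `L_∞`-morphism with `ι_{ρ(a)} ω = -d μ_1(a)`. -/
structure IsHomotopyMomentumMap {n : ℕ} (ω₀ : Form A (n + 1)) (ρ : 𝔤 →ₗ⁅ℝ⁆ VF A)
    (μ : ∀ i : ℕ, 𝔤 [⋀^Fin i]→ₗ[ℝ] Omega A) : Prop where
  premultisymplectic : IsPremultisymplectic ω₀ ρ
  morphism : IsLInftyMorphism (LInfty ω₀) μ
  hamiltonian : ∀ a : 𝔤, iota (ρ a) (incl A (n + 1) ω₀) = -dTot (μ 1 (fun _ => a))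

/-- The action admits a homotopy momentum map. -/
def IsHamiltonian {n : ℕ} (ω₀ : Form A (n + 1)) (ρ : 𝔤 →ₗ⁅ℝ⁆ VF A) : Prop :=
  ∃ μ, IsHomotopyMomentumMap ω₀ ρ μ

end Action

end Multisymp

end

/-!
A form of positive degree is determined by its contractions, so operator identities on `Ω^•(X)`
can be checked by induction on the degree; this gives `[L_v, d] = 0`, `[L_v, L_w] = L_{[v, w]}` and
`d² = 0` from Cartan's formula. Iterating Cartan's formula along `ρ` yields
`d ω_{k+1} = ± (dω)_{k+1} + ∑_i ± (L_{ρ(a_i)} ω)_k ± d_𝔤 ω_k`. For closed `ω` the last identity is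
`d̄ ω̄ = 0` as soon as `ω` is invariant, while the component of `d̄ ω̄` in `Ω^{1,•}` is
`a ↦ -L_{ρ(a)} ω`.

The brackets `l_k`, `k ≥ 2`, of `L_∞(X, ω)` vanish outside degree `0`, so only two compositions of
`m ≥ 2` contribute to the relations of a morphism `μ : 𝔤 → L_∞(X, ω)`: the composition with a single
block gives `d μ_m`, and the composition into ones gives `±ω_m`. Rescaling `μ_i` by
`-(-1)^{i(i+1)/2}` turns the relations into the components of `d̄ ν = ω̄`.
-/

noncomputable section

namespace Multisymp

section AlternatingMaps

variable {R M N : Type*} [CommRing R] [AddCommGroup M] [Module R M] [AddCommGroup N] [Module R N]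

theorem removeNth_succ_vecCons {α : Type*} {k : ℕ} (x : α) (u : Fin (k + 1) → α)
    (i : Fin (k + 1)) :
    i.succ.removeNth (Matrix.vecCons x u : Fin (k + 2) → α) =
      Matrix.vecCons x (i.removeNth u) := by
  funext j
  cases j using Fin.cases <;> simp [Fin.removeNth_apply]

theorem removeNth_zero_vecCons {α : Type*} {k : ℕ} (x : α) (u : Fin k → α) :
    (0 : Fin (k + 1)).removeNth (Matrix.vecCons x u : Fin (k + 1) → α) = u := rfl

theorem map_update_eq_smul_map_vecCons {k : ℕ} (α : M [⋀^Fin (k + 1)]→ₗ[R] N)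
    (w : Fin (k + 1) → M) (j : Fin (k + 1)) (x : M) :
    α (Function.update w j x) = (-1 : ℤ) ^ (j : ℕ) • α (Matrix.vecCons x (j.removeNth w)) := by
  rw [← Fin.insertNth_removeNth, AlternatingMap.map_insertNth]

theorem map_vecCons_vecCons_swap {k : ℕ} (α : M [⋀^Fin (k + 2)]→ₗ[R] N) (x y : M)
    (w : Fin k → M) :
    α (Matrix.vecCons x (Matrix.vecCons y w)) = -α (Matrix.vecCons y (Matrix.vecCons x w)) := by
  rw [← Matrix.cons_cons_comp_swap_zero_one, α.map_swap _ Fin.zero_ne_one]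

theorem sum_sign_smul_map_comp_perm {S P Q ι : Type*} [Semiring S] [AddCommMonoid P] [Module S P]
    [AddCommGroup Q] [Module S Q] [Fintype ι] [DecidableEq ι] (F : P [⋀^ι]→ₗ[S] Q) (v : ι → P) :
    ∑ σ : Equiv.Perm ι, (Equiv.Perm.sign σ : ℤ) • F (fun i => v (σ i)) =
      (Fintype.card ι).factorial • F v := by
  rw [← AlternatingMap.smul_apply, ← AlternatingMap.coe_alternatization,
    MultilinearMap.alternatization_apply]
  rfl

end AlternatingMaps

section ChevalleyEilenberg

variable {𝔤 : Type*} [LieRing 𝔤] [LieAlgebra ℝ 𝔤] {V : Type*} [AddCommGroup V] [Module ℝ V]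

theorem ceDiff_of_fin_zero (α : 𝔤 [⋀^Fin 0]→ₗ[ℝ] V) : ceDiff α = 0 := rfl

theorem ceDiff_compAlternatingMap {W : Type*} [AddCommGroup W] [Module ℝ W] {k : ℕ}
    (g : V →ₗ[ℝ] W) (α : 𝔤 [⋀^Fin k]→ₗ[ℝ] V) :
    ceDiff (g.compAlternatingMap α) = g.compAlternatingMap (ceDiff α) := by
  ext a
  cases k with
  | zero => exact (map_zero g).symm
  | succ k =>
    change -_ = g (-_)
    simp only [map_neg, map_sum, map_zsmul]
    rfl

theorem ceDiff_smul {k : ℕ} (c : ℝ) (α : 𝔤 [⋀^Fin k]→ₗ[ℝ] V) : ceDiff (c • α) = c • ceDiff α :=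
  ceDiff_compAlternatingMap (LinearMap.lsmul ℝ V c) α

theorem sum_lie_removeNth_succ_eq_ceDiff_curryLeft {k : ℕ} (α : 𝔤 [⋀^Fin (k + 1)]→ₗ[ℝ] V) (x : 𝔤)
    (w : Fin (k + 1) → 𝔤) :
    ∑ i : Fin k, ∑ j ∈ Finset.Ici i.succ, (-1 : ℤ) ^ ((i.succ : ℕ) + (j : ℕ)) •
        α (Matrix.vecCons ⁅w i.castSucc, w j⁆ (j.removeNth
          (i.succ.castSucc.removeNth (Matrix.vecCons x w : Fin (k + 2) → 𝔤)))) =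
      ceDiff (α.curryLeft x) w := by
  cases k with
  | zero => rfl
  | succ k =>
    change _ = -_
    simp only [← Finset.sum_neg_distrib]
    refine Finset.sum_congr rfl fun i _ => ?_
    rw [← Fin.map_succEmb_Ici, Finset.sum_map]
    refine Finset.sum_congr rfl fun j _ => ?_
    rw [Fin.coe_succEmb, Fin.castSucc_succ, removeNth_succ_vecCons, removeNth_succ_vecCons,
      map_vecCons_vecCons_swap, AlternatingMap.curryLeft_apply_apply, Fin.val_succ, Fin.val_succ,
      smul_neg, add_add_add_comm, pow_add _ _ (1 + 1), ← two_mul, pow_mul, neg_one_sq, one_pow,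
      mul_one]

theorem ceDiff_vecCons {k : ℕ} (α : 𝔤 [⋀^Fin (k + 1)]→ₗ[ℝ] V) (x : 𝔤) (w : Fin (k + 1) → 𝔤) :
    ceDiff α (Matrix.vecCons x w) =
      -ceDiff (α.curryLeft x) w - ∑ j, α (Function.update w j ⁅x, w j⁆) := by
  have hzero : ∑ j ∈ Finset.Ici (0 : Fin (k + 1)), (-1 : ℤ) ^ (((0 : Fin (k + 1)) : ℕ) + (j : ℕ)) •
      α (Matrix.vecCons ⁅x, w j⁆ (j.removeNth w)) =
        ∑ j, α (Function.update w j ⁅x, w j⁆) := by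
    simp only [map_update_eq_smul_map_vecCons, Fin.val_zero, zero_add]
    exact Finset.sum_congr (by ext; simp) fun _ _ => rfl
  rw [← sum_lie_removeNth_succ_eq_ceDiff_curryLeft α x w, ← hzero, sub_eq_add_neg,
    ← neg_add_rev]
  exact congrArg Neg.neg (Fin.sum_univ_succ _)

end ChevalleyEilenberg

section Cartan

variable {A : Type*} [CommRing A] [Algebra ℝ A]

/-- The interior product `ι_v` on `Ω^•(X)`, as a bilinear map. -/
def interior : VF A →ₗ[ℝ] Omega A →ₗ[ℝ] Omega A :=
  LinearMap.mk₂ ℝ iota (fun v w α => funext fun q => map_add (α (q + 1)).curryLeft v w)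
    (fun c v α => funext fun q => AlternatingMap.ext fun u =>
      AlternatingMap.map_vecCons_smul (α (q + 1)).toReal u c v)
    (fun _ _ _ => rfl) fun _ _ _ => rfl

theorem interior_swap (v w : VF A) (α : Omega A) :
    interior v (interior w α) = -interior w (interior v α) :=
  funext fun q => AlternatingMap.ext fun u => map_vecCons_vecCons_swap (α (q + 2)) w v u

theorem eq_zero_of_interior_comm {T : Omega A →ₗ[ℝ] Omega A} (c : ℤ) (hzero : ∀ α, T α 0 = 0)
    (hT : ∀ v α, interior v (T α) = c • T (interior v α)) : T = 0 := by
  suffices h : ∀ q α, T α q = 0 from LinearMap.ext fun α => funext fun q => h q α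
  intro q
  induction q with
  | zero => exact hzero
  | succ q ih =>
    intro α
    ext w
    have hw : interior (w 0) (T α) q = 0 := by rw [hT, Pi.smul_apply, ih, smul_zero]
    rw [← Fin.cons_self_tail w]
    exact DFunLike.congr_fun hw (Fin.tail w)

/-- The Lie derivative `L_v` on `Ω^•(X)`, defined by Cartan's formula; `lieTot_eq_lieDeriv`
identifies its components with `lieDeriv`. -/
def lieTot (v : VF A) : Omega A →ₗ[ℝ] Omega A := dTot ∘ₗ interior v + interior v ∘ₗ dTot

theorem lieTot_apply (v : VF A) (α : Omega A) :
    lieTot v α = dTot (interior v α) + interior v (dTot α) := rfl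

theorem interior_dTot (v : VF A) (α : Omega A) :
    interior v (dTot α) = lieTot v α - dTot (interior v α) :=
  (add_sub_cancel_left _ _).symm

theorem sum_smul_apply_removeNth_vecCons {q : ℕ} (v : VF A) (α : Form A (q + 1))
    (w : Fin (q + 1) → VF A) :
    ∑ i : Fin (q + 2), (-1 : ℤ) ^ (i : ℕ) • (Matrix.vecCons v w : Fin (q + 2) → VF A) i
        (α (i.removeNth (Matrix.vecCons v w : Fin (q + 2) → VF A))) =
      v (α w) -
        ∑ i : Fin (q + 1), (-1 : ℤ) ^ (i : ℕ) • w i (α.curryLeft v (i.removeNth w)) := by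
  rw [Fin.sum_univ_succ, Fin.val_zero, pow_zero, one_smul, removeNth_zero_vecCons,
    Matrix.cons_val_zero, sub_eq_add_neg, ← Finset.sum_neg_distrib]
  congr 1
  refine Finset.sum_congr rfl fun i _ => ?_
  rw [removeNth_succ_vecCons, Fin.val_succ, pow_succ, mul_neg_one, neg_smul]
  rfl

theorem extD_curryLeft_add_curryLeft_extD {q : ℕ} (v : VF A) (α : Form A (q + 1)) :
    extD (α.curryLeft v) + (extD α).curryLeft v = lieDeriv v α := by
  ext w
  change extDFun (α.curryLeft v) w + extDFun α (Matrix.vecCons v w) =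
    v (α w) - ∑ j, α.toReal (Function.update w j ⁅v, w j⁆)
  rw [extDFun, extDFun, sum_smul_apply_removeNth_vecCons, ceDiff_vecCons,
    show α.toReal.curryLeft v = Form.toReal (α.curryLeft v) from rfl]
  abel

theorem lieTot_eq_lieDeriv (v : VF A) (α : Omega A) (q : ℕ) :
    lieTot v α q = lieDeriv v (α q) := by
  cases q with
  | zero =>
    ext w
    change (0 : A) + extDFun (α 0) (Matrix.vecCons v w) = lieDerivFun v (α 0) w
    simp [extDFun, lieDerivFun, ceDiff_of_fin_zero]
  | succ q => exact extD_curryLeft_add_curryLeft_extD v (α (q + 1))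

theorem lieDeriv_curryLeft {q : ℕ} (v w : VF A) (α : Form A (q + 1)) :
    lieDeriv v (α.curryLeft w) = (lieDeriv v α).curryLeft w + α.curryLeft ⁅v, w⁆ := by
  ext u
  have hhead : Function.update (Matrix.vecCons w u : Fin (q + 1) → VF A) 0 ⁅v, w⁆ =
      Matrix.vecCons ⁅v, w⁆ u := Fin.update_cons_zero _ _ _
  have htail (j : Fin q) : Function.update (Matrix.vecCons w u : Fin (q + 1) → VF A) j.succ
      ⁅v, u j⁆ = Matrix.vecCons w (Function.update u j ⁅v, u j⁆) :=
    (Fin.cons_update _ _ _ _).symm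
  change lieDerivFun v (α.curryLeft w) u =
    lieDerivFun v α (Matrix.vecCons w u) + α (Matrix.vecCons ⁅v, w⁆ u)
  simp only [lieDerivFun, Fin.sum_univ_succ, Matrix.cons_val_zero, Matrix.cons_val_succ, hhead,
    htail, AlternatingMap.curryLeft_apply_apply]
  abel

theorem lieTot_interior (v w : VF A) (α : Omega A) :
    lieTot v (interior w α) = interior w (lieTot v α) + interior ⁅v, w⁆ α := by
  funext q
  change _ = (lieTot v α (q + 1)).curryLeft w + (α (q + 1)).curryLeft ⁅v, w⁆
  rw [lieTot_eq_lieDeriv, lieTot_eq_lieDeriv]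
  exact lieDeriv_curryLeft v w (α (q + 1))

theorem interior_lieTot (v w : VF A) (α : Omega A) :
    interior w (lieTot v α) = lieTot v (interior w α) - interior ⁅v, w⁆ α := by
  rw [lieTot_interior, add_sub_cancel_right]

theorem lieDeriv_lieDeriv_of_fin_zero (v w : VF A) (α : Form A 0) :
    lieDeriv v (lieDeriv w α) - lieDeriv w (lieDeriv v α) = lieDeriv ⁅v, w⁆ α := by
  ext u
  simp [lieDeriv, lieDerivFun, Derivation.commutator_apply]

theorem lieTot_lieTot_sub (v w : VF A) (α : Omega A) :
    lieTot v (lieTot w α) - lieTot w (lieTot v α) = lieTot ⁅v, w⁆ α := by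
  suffices h : lieTot v ∘ₗ lieTot w - lieTot w ∘ₗ lieTot v - lieTot ⁅v, w⁆ = 0 from
    sub_eq_zero.1 (LinearMap.congr_fun h α)
  refine eq_zero_of_interior_comm 1 (fun α => ?_) fun u α => ?_
  · change lieTot v (lieTot w α) 0 - lieTot w (lieTot v α) 0 - lieTot ⁅v, w⁆ α 0 = 0
    simp only [lieTot_eq_lieDeriv, lieDeriv_lieDeriv_of_fin_zero, sub_self]
  · simp only [LinearMap.sub_apply, LinearMap.comp_apply, map_sub, interior_lieTot, one_smul]
    rw [leibniz_lie v w u, map_add, LinearMap.add_apply]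
    abel

theorem lieDeriv_zero {q : ℕ} (v : VF A) : lieDeriv v (0 : Form A q) = 0 := by
  ext u
  simp [lieDeriv, lieDerivFun]

theorem lieTot_dTot (v : VF A) (α : Omega A) : lieTot v (dTot α) = dTot (lieTot v α) := by
  suffices h : lieTot v ∘ₗ dTot - dTot ∘ₗ lieTot v = 0 from
    sub_eq_zero.1 (LinearMap.congr_fun h α)
  refine eq_zero_of_interior_comm (-1) (fun α => ?_) fun w α => ?_
  · change lieTot v (dTot α) 0 - 0 = 0
    rw [lieTot_eq_lieDeriv, sub_zero]
    exact lieDeriv_zero v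
  · simp only [LinearMap.sub_apply, LinearMap.comp_apply, map_sub, interior_lieTot, interior_dTot,
      ← lieTot_lieTot_sub v w]
    abel

theorem dTot_dTot (α : Omega A) : dTot (dTot α) = 0 := by
  suffices h : dTot ∘ₗ dTot = (0 : Omega A →ₗ[ℝ] Omega A) from LinearMap.congr_fun h α
  refine eq_zero_of_interior_comm 1 (fun α => rfl) fun w α => ?_
  simp only [LinearMap.comp_apply, map_sub, interior_dTot, lieTot_dTot, one_smul]
  abel

theorem dTot_incl {q : ℕ} (α : Form A q) : dTot (incl A q α) = incl A (q + 1) (extD α) := by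
  funext r
  cases r with
  | zero => exact (Pi.single_eq_of_ne (M := Form A) (Nat.succ_ne_zero q).symm (extD α)).symm
  | succ r =>
    change extD (Pi.single (M := Form A) q α r) = Pi.single (M := Form A) (q + 1) (extD α) (r + 1)
    obtain rfl | hr := eq_or_ne r q
    · simp only [Pi.single_eq_same]
    · rw [Pi.single_eq_of_ne hr, Pi.single_eq_of_ne (by simpa using hr), map_zero]

theorem lieTot_incl {q : ℕ} (v : VF A) (α : Form A q) :
    lieTot v (incl A q α) = incl A q (lieDeriv v α) := by
  funext r
  rw [lieTot_eq_lieDeriv]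
  exact Pi.apply_single (fun r => lieDeriv (q := r) v) (fun r => lieDeriv_zero v) q α r

end Cartan

section IteratedContraction

variable {A : Type*} [CommRing A] [Algebra ℝ A]
variable {𝔤 : Type*} [LieRing 𝔤] [LieAlgebra ℝ 𝔤]

/-- The iterated interior product `ι_{χ_k} ⋯ ι_{χ_1}`, as a linear endomorphism of `Ω^•(X)`. -/
def iteratedInterior {k : ℕ} (χ : Fin k → VF A) : Omega A →ₗ[ℝ] Omega A where
  toFun := iotaIter χ
  map_add' α β := by
    funext q
    ext w
    simp only [iotaIter_apply, Pi.add_apply, AlternatingMap.add_apply]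
  map_smul' c α := by
    funext q
    ext w
    change _ = c • iotaIter χ α q w
    rw [iotaIter_apply, iotaIter_apply]
    rfl

theorem iotaIter_congr {k : ℕ} {χ ξ : Fin k → VF A} {α : Omega A}
    (h : ∀ j, interior (χ j) α = interior (ξ j) α) : iotaIter χ α = iotaIter ξ α := by
  induction k generalizing α with
  | zero => rfl
  | succ k ih =>
    change iotaIter (Fin.tail χ) (interior (χ 0) α) = iotaIter (Fin.tail ξ) (interior (ξ 0) α)
    rw [h 0]
    refine ih fun j => ?_
    rw [interior_swap, interior_swap (Fin.tail ξ j)]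
    exact congrArg (fun β => -interior (ξ 0) β) (h j.succ)

theorem iotaIter_eq_zero {k : ℕ} {χ : Fin k → VF A} {α : Omega A} (j : Fin k)
    (h : interior (χ j) α = 0) : iotaIter χ α = 0 := by
  induction k generalizing α with
  | zero => exact j.elim0
  | succ k ih =>
    change iotaIter (Fin.tail χ) (interior (χ 0) α) = 0
    cases j using Fin.cases with
    | zero => rw [h]; exact map_zero (iteratedInterior _)
    | succ j => exact ih j (by rw [interior_swap, show interior (Fin.tail χ j) α = 0 from h,
        map_zero, neg_zero])

/-- `β ↦ (a_1 ∧ ⋯ ∧ a_p ↦ ι_{ρ(a_p)} ⋯ ι_{ρ(a_1)} β)`, with values in forms of all degrees;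
its components are the maps `contraction ρ β p q`. -/
def contractionTot (ρ : 𝔤 →ₗ⁅ℝ⁆ VF A) (p : ℕ) : Omega A →ₗ[ℝ] 𝔤 [⋀^Fin p]→ₗ[ℝ] Omega A where
  toFun β := AlternatingMap.pi (contraction ρ β p)
  map_add' α β := AlternatingMap.ext fun a => map_add (iteratedInterior fun j => ρ (a j)) α β
  map_smul' c β := AlternatingMap.ext fun a => map_smul (iteratedInterior fun j => ρ (a j)) c β

theorem contractionTot_vecCons (ρ : 𝔤 →ₗ⁅ℝ⁆ VF A) {p : ℕ} (β : Omega A) (x : 𝔤)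
    (a : Fin p → 𝔤) :
    contractionTot ρ (p + 1) β (Matrix.vecCons x a) =
      contractionTot ρ p (interior (ρ x) β) a := rfl

theorem contractionTot_curryLeft (ρ : 𝔤 →ₗ⁅ℝ⁆ VF A) {p : ℕ} (β : Omega A) (x : 𝔤) :
    (contractionTot ρ (p + 1) β).curryLeft x = contractionTot ρ p (interior (ρ x) β) := rfl

theorem contractionTot_lieTot_interior (ρ : 𝔤 →ₗ⁅ℝ⁆ VF A) {k : ℕ} (β : Omega A) (x : 𝔤)
    (a : Fin (k + 1) → 𝔤) (i : Fin (k + 1)) :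
    (-1 : ℤ) ^ (k + i : ℕ) •
        contractionTot ρ k (lieTot (ρ (a i)) (interior (ρ x) β)) (i.removeNth a) =
      (-1 : ℤ) ^ (k + 1 + i.succ : ℕ) • contractionTot ρ (k + 1) (lieTot (ρ (a i)) β)
          (i.succ.removeNth (Matrix.vecCons x a)) +
        (-1 : ℤ) ^ (k + 1) •
          contractionTot ρ (k + 1) β (Function.update a i ⁅x, a i⁆) := by
  have hbracket : interior ⁅ρ (a i), ρ x⁆ β = -interior (ρ ⁅x, a i⁆) β := by
    rw [← LieHom.map_lie, ← lie_skew, map_neg, map_neg]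
    rfl
  rw [lieTot_interior, hbracket, map_add, AlternatingMap.add_apply, smul_add,
    removeNth_succ_vecCons, contractionTot_vecCons, map_update_eq_smul_map_vecCons,
    contractionTot_vecCons, map_neg, AlternatingMap.neg_apply, smul_neg, smul_smul, ← neg_smul,
    Fin.val_succ]
  congr 2 <;> ring

theorem dTot_contractionTot (ρ : 𝔤 →ₗ⁅ℝ⁆ VF A) {k : ℕ} (β : Omega A) (a : Fin (k + 1) → 𝔤) :
    dTot (contractionTot ρ (k + 1) β a) =
      (-1 : ℤ) ^ (k + 1) • contractionTot ρ (k + 1) (dTot β) a +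
      ∑ i : Fin (k + 1), (-1 : ℤ) ^ (k + i : ℕ) •
        contractionTot ρ k (lieTot (ρ (a i)) β) (i.removeNth a) +
      (-1 : ℤ) ^ (k + 1) • ceDiff (contractionTot ρ k β) a := by
  induction k generalizing β with
  | zero =>
    change dTot (interior (ρ (a 0)) β) = (-1 : ℤ) ^ 1 • interior (ρ (a 0)) (dTot β) +
      ∑ i : Fin 1, (-1 : ℤ) ^ (0 + i : ℕ) • lieTot (ρ (a i)) β + (-1 : ℤ) ^ 1 • (0 : Omega A)
    simp [interior_dTot]
  | succ k ih =>
    obtain ⟨x, b, rfl⟩ : ∃ x b, a = Matrix.vecCons x b :=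
      ⟨a 0, Fin.tail a, (Fin.cons_self_tail a).symm⟩
    have hd : dTot (interior (ρ x) β) = lieTot (ρ x) β - interior (ρ x) (dTot β) := by
      rw [interior_dTot, sub_sub_cancel]
    rw [contractionTot_vecCons, ih, Fin.sum_univ_succ (n := k + 1), ceDiff_vecCons,
      contractionTot_curryLeft, hd, map_sub, AlternatingMap.sub_apply]
    simp only [contractionTot_lieTot_interior, Finset.sum_add_distrib, ← Finset.smul_sum,
      Matrix.cons_val_zero, removeNth_zero_vecCons, Fin.val_zero, add_zero, Matrix.cons_val_succ,
      contractionTot_vecCons, pow_succ _ (k + 1), mul_neg_one, neg_smul, smul_sub, smul_neg]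
    abel

theorem ceDiff_contractionTot {ρ : 𝔤 →ₗ⁅ℝ⁆ VF A} {β : Omega A} (hd : dTot β = 0)
    (hL : ∀ a, lieTot (ρ a) β = 0) (k : ℕ) :
    ceDiff (contractionTot ρ k β) =
      (-1 : ℝ) ^ (k + 1) • dTot.compAlternatingMap (contractionTot ρ (k + 1) β) := by
  ext a : 1
  rw [AlternatingMap.smul_apply, LinearMap.compAlternatingMap_apply, dTot_contractionTot]
  simp only [hd, hL, map_zero, AlternatingMap.zero_apply, smul_zero, Finset.sum_const_zero,
    zero_add]
  rcases Nat.even_or_odd (k + 1) with hk | hk <;> simp [hk.neg_one_pow]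

end IteratedContraction

section TotalComplex

variable {A : Type*} [CommRing A] [Algebra ℝ A]
variable {𝔤 : Type*} [LieRing 𝔤] [LieAlgebra ℝ 𝔤]

/-- The family `α^{p,•}`, as a single map with values in forms of all degrees. -/
def row (α : BiForm A 𝔤) (p : ℕ) : 𝔤 [⋀^Fin p]→ₗ[ℝ] Omega A := AlternatingMap.pi (α p)

theorem dX_apply (α : BiForm A 𝔤) (p q : ℕ) (a : Fin p → 𝔤) :
    dX α p q a = ((-1 : ℝ) ^ p • dTot (row α p a)) q := by
  cases q with
  | zero => exact (smul_zero ((-1 : ℝ) ^ p) : (-1 : ℝ) ^ p • (0 : Form A 0) = 0).symm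
  | succ q => rfl

theorem row_dBar_succ (α : BiForm A 𝔤) (p : ℕ) :
    row (dBar α) (p + 1) =
      ceDiff (row α p) + (-1 : ℝ) ^ (p + 1) • dTot.compAlternatingMap (row α (p + 1)) := by
  ext a : 1
  funext q
  change ceDiff (α p q) a + dX α (p + 1) q a = _
  rw [dX_apply, AlternatingMap.add_apply, Pi.add_apply]
  congr 1
  exact DFunLike.congr_fun (ceDiff_compAlternatingMap (LinearMap.proj q) (row α p)) a

theorem dBar_apply_zero {α : BiForm A 𝔤} (hα : α 0 = 0) : dBar α 0 = 0 := by
  have hrow : row α 0 = 0 := by rw [row, hα]; rfl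
  funext q
  ext a : 1
  change 0 + dX α 0 q a = 0
  rw [dX_apply, hrow, AlternatingMap.zero_apply, map_zero, smul_zero, zero_add]
  rfl

theorem eq_of_row_eq {α β : BiForm A 𝔤} (h : row α = row β) : α = β :=
  funext fun p => funext fun q => AlternatingMap.ext fun a =>
    congrFun (DFunLike.congr_fun (congrFun h p) a) q

theorem dBar_eq_iff {α β : BiForm A 𝔤} (hα : α 0 = 0) (hβ : β 0 = 0) :
    dBar α = β ↔ ∀ p, ceDiff (row α p) +
      (-1 : ℝ) ^ (p + 1) • dTot.compAlternatingMap (row α (p + 1)) = row β (p + 1) := by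
  simp only [← row_dBar_succ]
  refine ⟨fun h p => by rw [h], fun h => eq_of_row_eq (funext fun p => ?_)⟩
  cases p with
  | zero => rw [row, row, dBar_apply_zero hα, hβ]
  | succ p => exact h p

theorem bar_apply_zero (ρ : 𝔤 →ₗ⁅ℝ⁆ VF A) {m : ℕ} (β : Form A m) : bar ρ β 0 = 0 := rfl

theorem row_bar_succ (ρ : 𝔤 →ₗ⁅ℝ⁆ VF A) {m : ℕ} (β : Form A m) (p : ℕ) :
    row (bar ρ β) (p + 1) = (-1 : ℝ) ^ p • contractionTot ρ (p + 1) (incl A m β) := rfl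

theorem isPremultisymplectic_iff_lieTot_eq_zero {m : ℕ} {β : Form A m} {ρ : 𝔤 →ₗ⁅ℝ⁆ VF A} :
    IsPremultisymplectic β ρ ↔ ∀ a, lieTot (ρ a) (incl A m β) = 0 := by
  refine forall_congr' fun a => ?_
  rw [lieTot_incl]
  exact ((Pi.single_injective m).eq_iff' (map_zero (incl A m))).symm

theorem isPremultisymplectic_iff_dTot_interior_eq_zero {m : ℕ} {β : Form A m} (hβ : extD β = 0)
    {ρ : 𝔤 →ₗ⁅ℝ⁆ VF A} :
    IsPremultisymplectic β ρ ↔ ∀ a, dTot (interior (ρ a) (incl A m β)) = 0 := by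
  simp only [isPremultisymplectic_iff_lieTot_eq_zero, lieTot_apply, dTot_incl, hβ, map_zero,
    add_zero]

theorem isPremultisymplectic_iff_dBar_bar_eq_zero {m : ℕ} {β : Form A m} (hβ : extD β = 0)
    {ρ : 𝔤 →ₗ⁅ℝ⁆ VF A} : IsPremultisymplectic β ρ ↔ dBar (bar ρ β) = 0 := by
  rw [dBar_eq_iff (bar_apply_zero ρ β) rfl]
  constructor
  · rintro h (_ | p)
    · ext a : 1
      change (0 : Omega A) + (-1 : ℝ) ^ 1 • dTot (row (bar ρ β) 1 a) = 0
      rw [row_bar_succ, pow_zero, one_smul, zero_add]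
      exact (congrArg _ ((isPremultisymplectic_iff_dTot_interior_eq_zero hβ).1 h (a 0))).trans
        (smul_zero (A := Omega A) _)
    · have hL := isPremultisymplectic_iff_lieTot_eq_zero.1 h
      have hd : dTot (incl A m β) = 0 := by rw [dTot_incl, hβ, map_zero]
      ext a : 1
      change ceDiff (row (bar ρ β) (p + 1)) a +
        (-1 : ℝ) ^ (p + 2) • dTot (row (bar ρ β) (p + 2) a) = 0
      rw [row_bar_succ, row_bar_succ, ceDiff_smul, ceDiff_contractionTot hd hL]
      simp only [AlternatingMap.smul_apply, map_smul, LinearMap.compAlternatingMap_apply]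
      module
  · intro h
    rw [isPremultisymplectic_iff_dTot_interior_eq_zero hβ]
    intro a
    have h0 : (0 : Omega A) + (-1 : ℝ) ^ 1 • dTot (interior (ρ a) (incl A m β)) = 0 := by
      have := DFunLike.congr_fun (h 0) fun _ => a
      rw [row_bar_succ, pow_zero, one_smul] at this
      exact this
    rw [zero_add] at h0
    exact (smul_eq_zero_iff_right (by norm_num)).1 h0

end TotalComplex

section LInftyMorphisms

variable {𝔤 : Type*} [LieRing 𝔤] [LieAlgebra ℝ 𝔤] {L : Type*} [AddCommGroup L] [Module ℝ L]

/-- The coefficient, Koszul sign included, with which a composition of `m` enters the relations of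
an `L_∞`-morphism. -/
def morphismCoeff {m : ℕ} (c : Composition m) : ℝ :=
  (-1) ^ (∑ j : Fin c.length, (c.length - 1 - (j : ℕ)) * (c.blocksFun j - 1)) /
    (c.length.factorial * ∏ j, ((c.blocksFun j).factorial : ℝ))

/-- The bracket `l_k(f_{c_1}(b_1, …), …, f_{c_k}(…, b_m))` attached to the composition
`m = c_1 + ⋯ + c_k`. -/
def blockBracket (B : GradedBrackets L) (f : ∀ i : ℕ, 𝔤 [⋀^Fin i]→ₗ[ℝ] L) {m : ℕ}
    (c : Composition m) (b : Fin m → 𝔤) : L :=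
  B.bracket c.length fun j => f (c.blocksFun j) fun t => b (c.embedding j t)

/-- The summand attached to a composition in the relations of an `L_∞`-morphism. -/
def morphismTerm (B : GradedBrackets L) (f : ∀ i : ℕ, 𝔤 [⋀^Fin i]→ₗ[ℝ] L) {m : ℕ}
    (a : Fin m → 𝔤) (c : Composition m) : L :=
  morphismCoeff c •
    ∑ σ : Equiv.Perm (Fin m), (Equiv.Perm.sign σ : ℤ) • blockBracket B f c fun i => a (σ i)

variable {B : GradedBrackets L} {f : ∀ i : ℕ, 𝔤 [⋀^Fin i]→ₗ[ℝ] L}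

theorem morphismTerm_eq_smul {m : ℕ} {c : Composition m} {G : 𝔤 [⋀^Fin m]→ₗ[ℝ] L}
    (h : ∀ b, blockBracket B f c b = G b) (a : Fin m → 𝔤) :
    morphismTerm B f a c = (morphismCoeff c * m.factorial) • G a := by
  simp only [morphismTerm, h, sum_sign_smul_map_comp_perm, Fintype.card_fin, mul_smul,
    Nat.cast_smul_eq_nsmul]

theorem morphismCoeff_single_mul_factorial {m : ℕ} (hm : 0 < m) :
    morphismCoeff (Composition.single m hm) * m.factorial = 1 := by
  have hblocks : ∏ j, (((Composition.single m hm).blocksFun j).factorial : ℝ) = m.factorial :=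
    Fin.prod_univ_one fun j => (((Composition.single m hm).blocksFun j).factorial : ℝ)
  rw [morphismCoeff, hblocks]
  simp [Nat.factorial_ne_zero]

theorem morphismCoeff_ones_mul_factorial (m : ℕ) :
    morphismCoeff (Composition.ones m) * m.factorial = 1 := by
  simp [morphismCoeff, Nat.factorial_ne_zero]

theorem blockBracket_single {m : ℕ} (hm : 0 < m) (b : Fin m → 𝔤) :
    blockBracket B f (Composition.single m hm) b = B.bracket 1 fun _ => f m b := by
  refine congrArg (B.bracket 1) (funext fun j => ?_)
  obtain rfl := Subsingleton.elim (α := Fin 1) j 0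
  exact congrArg (f m) (funext fun t => congrArg b (Composition.single_embedding hm t))

theorem bracket_eq_of_forall_cast {k l : ℕ} (h : k = l) {v : Fin k → L} {w : Fin l → L}
    (hvw : ∀ j, v j = w (Fin.cast h j)) : B.bracket k v = B.bracket l w := by
  subst h
  exact congrArg _ (funext hvw)

theorem apply_of_eq_one {m : ℕ} (hm : m = 1) (u : Fin m → 𝔤) (t : Fin m) :
    f m u = f 1 fun _ => u t := by
  subst hm
  exact congrArg (f 1) (funext fun s => congrArg u (Subsingleton.elim s t))

theorem blockBracket_ones {m : ℕ} (b : Fin m → 𝔤) :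
    blockBracket B f (Composition.ones m) b = B.bracket m fun j => f 1 fun _ => b j := by
  refine bracket_eq_of_forall_cast (Composition.ones_length m) fun j => ?_
  have hpos : 0 < (Composition.ones m).blocksFun j := by simp
  rw [apply_of_eq_one (Composition.ones_blocksFun m j) _ ⟨0, hpos⟩,
    Composition.ones_embedding j hpos]
  rfl

theorem morphismTerm_single {m : ℕ} (hm : 0 < m) {D : 𝔤 [⋀^Fin m]→ₗ[ℝ] L}
    (hD : ∀ b, B.bracket 1 (fun _ => f m b) = D b) (a : Fin m → 𝔤) :
    morphismTerm B f a (Composition.single m hm) = D a := by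
  rw [morphismTerm_eq_smul fun b => (blockBracket_single hm b).trans (hD b),
    morphismCoeff_single_mul_factorial, one_smul]

theorem morphismTerm_ones {m : ℕ} {G : 𝔤 [⋀^Fin m]→ₗ[ℝ] L}
    (hG : ∀ b, (B.bracket m fun j => f 1 fun _ => b j) = G b) (a : Fin m → 𝔤) :
    morphismTerm B f a (Composition.ones m) = G a := by
  rw [morphismTerm_eq_smul fun b => (blockBracket_ones b).trans (hG b),
    morphismCoeff_ones_mul_factorial, one_smul]

theorem sum_morphismTerm_one {D : 𝔤 [⋀^Fin 1]→ₗ[ℝ] L}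
    (hD : ∀ b, B.bracket 1 (fun _ => f 1 b) = D b) (a : Fin 1 → 𝔤) :
    ∑ c : Composition 1, morphismTerm B f a c = D a := by
  rw [Fintype.sum_eq_single (Composition.single 1 one_pos), morphismTerm_single one_pos hD]
  intro c hc
  exact absurd ((Composition.eq_single_iff_length one_pos).2
    (le_antisymm c.length_le (c.length_pos_of_pos one_pos))) hc

/-- Multibrackets with at least two arguments that vanish unless all arguments have degree `0`. -/
def IsConcentratedInDegreeZero (B : GradedBrackets L) : Prop :=
  ∀ ⦃k : ℕ⦄ ⦃v : Fin k → L⦄ ⦃j : Fin k⦄ ⦃i : ℤ⦄, 2 ≤ k → i ≠ 0 → v j ∈ B.part i →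
    B.bracket k v = 0

theorem morphismTerm_eq_zero (hB : IsConcentratedInDegreeZero B)
    (hf : ∀ i : ℕ, 1 ≤ i → ∀ a, f i a ∈ B.part (1 - (i : ℤ))) {m : ℕ} {c : Composition m}
    (hlength : 2 ≤ c.length) (hones : c ≠ Composition.ones m) (a : Fin m → 𝔤) :
    morphismTerm B f a c = 0 := by
  obtain ⟨s, hs, hs1⟩ := Composition.ne_ones_iff.1 hones
  obtain ⟨j, rfl⟩ : ∃ j, c.blocksFun j = s := List.mem_iff_get.1 hs
  have hzero (b : Fin m → 𝔤) : blockBracket B f c b = (0 : 𝔤 [⋀^Fin m]→ₗ[ℝ] L) b :=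
    hB hlength (i := 1 - (c.blocksFun j : ℤ)) (by omega) (hf _ (by omega) _)
  rw [morphismTerm_eq_smul hzero, AlternatingMap.zero_apply, smul_zero]

theorem sum_morphismTerm_of_one_lt (hB : IsConcentratedInDegreeZero B)
    (hf : ∀ i : ℕ, 1 ≤ i → ∀ a, f i a ∈ B.part (1 - (i : ℤ))) {m : ℕ} (hm : 1 < m)
    {D G : 𝔤 [⋀^Fin m]→ₗ[ℝ] L} (hD : ∀ b, B.bracket 1 (fun _ => f m b) = D b)
    (hG : ∀ b, (B.bracket m fun j => f 1 fun _ => b j) = G b) (a : Fin m → 𝔤) :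
    ∑ c : Composition m, morphismTerm B f a c = D a + G a := by
  have hpos : 0 < m := one_pos.trans hm
  rw [Fintype.sum_eq_add (Composition.single m hpos) (Composition.ones m),
    morphismTerm_single hpos hD, morphismTerm_ones hG]
  · intro h
    have hlength := congrArg Composition.length h
    rw [Composition.single_length, Composition.ones_length] at hlength
    omega
  · rintro c ⟨hsingle, hones⟩
    have hlength_pos := c.length_pos_of_pos hpos
    have hlength_ne : c.length ≠ 1 := mt (Composition.eq_single_iff_length hpos).2 hsingle
    exact morphismTerm_eq_zero hB hf (by omega) hones a

end LInftyMorphisms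

section ObservablesBrackets

variable {A : Type*} [CommRing A] [Algebra ℝ A] {n : ℕ} {ω₀ : Form A (n + 1)}

theorem isHamVF_hamVF {α : Omega A} (h : α ∈ LInftyPart ω₀ 0) : IsHamVF ω₀ α (hamVF ω₀ α) := by
  rw [hamVF, dif_pos (h.2 rfl)]
  exact (h.2 rfl).choose_spec

theorem eq_zero_of_mem_LInftyPart {α : Omega A} {i : ℤ} (hi : i ≠ 0) (h : α ∈ LInftyPart ω₀ i)
    (h0 : α ∈ LInftyPart ω₀ 0) : α = 0 := by
  funext q
  by_cases hq : (q : ℤ) = n - 1 + i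
  · exact h0.1 q fun h' => by omega
  · exact h.1 q fun h' => hq h'.2

theorem isConcentratedInDegreeZero_LInfty : IsConcentratedInDegreeZero (LInfty ω₀) := by
  intro k α j i hk hi hj
  change LInftyBracket ω₀ k α = 0
  obtain ⟨k, rfl⟩ := Nat.exists_eq_add_of_le' hk
  rw [LInftyBracket]
  split_ifs with h0
  · have hχ := isHamVF_hamVF (h0 j)
    rw [IsHamVF, eq_zero_of_mem_LInftyPart hi hj (h0 j), map_zero, neg_zero] at hχ
    rw [iotaIter_eq_zero j (by rw [eq_zero_of_mem_LInftyPart hi hj (h0 j)]; exact hχ), smul_zero]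
  · rfl

theorem LInftyBracket_one_of_neg {α : Omega A} {i : ℤ} (hi : i < 0) (h : α ∈ LInftyPart ω₀ i) :
    LInftyBracket ω₀ 1 (fun _ => α) = dTot α := by
  refine congrArg dTot (funext fun q => ?_)
  split_ifs with hq
  · rfl
  · exact (h.1 q fun h' => by omega).symm

theorem LInftyBracket_one_of_zero {α : Omega A} (h : α ∈ LInftyPart ω₀ 0) :
    LInftyBracket ω₀ 1 (fun _ => α) = 0 := by
  refine (congrArg dTot (funext fun q => ?_)).trans (map_zero dTot)
  split_ifs with hq
  · exact h.1 q fun h' => by omega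
  · rfl

/-- The sign `-(-1)^{i(i+1)/2}` in the brackets of `L_∞(X, ω)` and in the passage from `ν` to the
components of a homotopy momentum map. -/
def momentumSign (i : ℕ) : ℝ := -(-1) ^ (i * (i + 1) / 2)

theorem momentumSign_mul_self (i : ℕ) : momentumSign i * momentumSign i = 1 := by
  rw [momentumSign, neg_mul_neg, ← pow_add, Even.neg_one_pow ⟨_, rfl⟩]

theorem momentumSign_succ (i : ℕ) : momentumSign (i + 1) = (-1) ^ (i + 1) * momentumSign i := by
  rw [momentumSign, momentumSign, mul_neg, ← pow_add,
    show (i + 1) * (i + 1 + 1) = i * (i + 1) + (i + 1) * 2 by ring,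
    Nat.add_mul_div_right _ _ zero_lt_two, add_comm]

theorem LInftyBracket_of_isHamVF {k : ℕ} (hk : 2 ≤ k) {α : Fin k → Omega A} {χ : Fin k → VF A}
    (h : ∀ j, α j ∈ LInftyPart ω₀ 0) (hχ : ∀ j, IsHamVF ω₀ (α j) (χ j)) :
    LInftyBracket ω₀ k α = momentumSign k • iotaIter χ (incl A (n + 1) ω₀) := by
  obtain ⟨k, rfl⟩ := Nat.exists_eq_add_of_le' hk
  rw [LInftyBracket, if_pos h]
  exact congrArg _ (iotaIter_congr fun j => (isHamVF_hamVF (h j)).trans (hχ j).symm)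

variable {𝔤 : Type*} [LieRing 𝔤] [LieAlgebra ℝ 𝔤]

theorem sum_morphismTerm_LInfty {ρ : 𝔤 →ₗ⁅ℝ⁆ VF A} {f : ∀ i : ℕ, 𝔤 [⋀^Fin i]→ₗ[ℝ] Omega A}
    (hf : ∀ i : ℕ, 1 ≤ i → ∀ a, f i a ∈ LInftyPart ω₀ (1 - (i : ℤ)))
    (hham : ∀ a, IsHamVF ω₀ (f 1 fun _ => a) (ρ a)) (r : ℕ) (a : Fin (r + 1) → 𝔤) :
    ∑ c, morphismTerm (LInfty ω₀) f a c = dTot (f (r + 1) a) +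
      momentumSign (r + 1) • contractionTot ρ (r + 1) (incl A (n + 1) ω₀) a := by
  have hf0 (b : Fin 1 → 𝔤) : f 1 b ∈ LInftyPart ω₀ 0 := hf 1 le_rfl b
  cases r with
  | zero =>
    have hD (b : Fin 1 → 𝔤) :
        (LInfty ω₀).bracket 1 (fun _ => f 1 b) = (0 : 𝔤 [⋀^Fin 1]→ₗ[ℝ] Omega A) b :=
      LInftyBracket_one_of_zero (hf0 b)
    have hι : contractionTot ρ 1 (incl A (n + 1) ω₀) a = -dTot (f 1 a) :=
      (hham (a 0)).trans (congrArg (-dTot ·) (apply_of_eq_one rfl a 0).symm)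
    rw [sum_morphismTerm_one hD, AlternatingMap.zero_apply, hι]
    simp [momentumSign]
  | succ r =>
    refine sum_morphismTerm_of_one_lt isConcentratedInDegreeZero_LInfty hf (by omega)
      (D := dTot.compAlternatingMap (f (r + 2)))
      (G := momentumSign (r + 2) • contractionTot ρ (r + 2) (incl A (n + 1) ω₀))
      (fun b => ?_) (fun b => ?_) a
    · exact LInftyBracket_one_of_neg (by push_cast; omega) (hf (r + 2) (by omega) b)
    · exact LInftyBracket_of_isHamVF (by omega) (fun j => hf0 _) fun j => hham (b j)

end ObservablesBrackets

section MomentumMaps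

variable {A : Type*} [CommRing A] [Algebra ℝ A]
variable {𝔤 : Type*} [LieRing 𝔤] [LieAlgebra ℝ 𝔤]
variable {n : ℕ} {ω₀ : Form A (n + 1)} {ρ : 𝔤 →ₗ⁅ℝ⁆ VF A} {ν : BiForm A 𝔤}

/-- The maps `μ_i = -(-1)^{i(i+1)/2} ν^{(i,•)}`. -/
def momentumComponents (ν : BiForm A 𝔤) (i : ℕ) : 𝔤 [⋀^Fin i]→ₗ[ℝ] Omega A :=
  momentumSign i • row ν i

theorem row_eq_momentumSign_smul (ν : BiForm A 𝔤) (i : ℕ) :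
    row ν i = momentumSign i • momentumComponents ν i := by
  rw [momentumComponents, smul_smul, momentumSign_mul_self, one_smul]

theorem momentumComponents_surjective :
    Function.Surjective (momentumComponents (A := A) (𝔤 := 𝔤)) := by
  intro μ
  let ν : BiForm A 𝔤 := fun p q => (LinearMap.proj q).compAlternatingMap (momentumSign p • μ p)
  have hrow (p : ℕ) : row ν p = momentumSign p • μ p := rfl
  exact ⟨ν, funext fun p => by
    rw [momentumComponents, hrow, smul_smul, momentumSign_mul_self, one_smul]⟩

theorem momentumComponents_one (ν : BiForm A 𝔤) : momentumComponents ν 1 = row ν 1 := by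
  simp [momentumComponents, momentumSign]

theorem momentumComponents_eq_smul_compAlternatingMap (hν : ν ∈ totalDegree A 𝔤 n) :
    momentumComponents ν = fun i => (-(-1 : ℝ) ^ (i * (i + 1) / 2)) •
      (incl A (n - i)).compAlternatingMap (ν i (n - i)) := by
  funext i
  refine congrArg (momentumSign i • ·) (AlternatingMap.ext fun a => funext fun q => ?_)
  change ν i q a = Pi.single (M := Form A) (n - i) (ν i (n - i) a) q
  by_cases h : q = n - i
  · subst h
    rw [Pi.single_eq_same]
  · rw [Pi.single_eq_of_ne h, hν i q (by omega)]
    rfl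

theorem apply_zero_of_mem_totalDegree (hν : ν ∈ totalDegree A 𝔤 n) : ν 0 = 0 :=
  funext fun q => hν 0 q (by omega)

theorem relation_momentumComponents_iff
    (hf : ∀ i : ℕ, 1 ≤ i → ∀ a, momentumComponents ν i a ∈ LInftyPart ω₀ (1 - (i : ℤ)))
    (hham : ∀ a, IsHamVF ω₀ (momentumComponents ν 1 fun _ => a) (ρ a)) (r : ℕ)
    (a : Fin (r + 1) → 𝔤) :
    -ceDiff (momentumComponents ν r) a =
        ∑ c, morphismTerm (LInfty ω₀) (momentumComponents ν) a c ↔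
      ceDiff (row ν r) a + (-1 : ℝ) ^ (r + 1) • dTot (row ν (r + 1) a) =
        row (bar ρ ω₀) (r + 1) a := by
  have hsq := momentumSign_mul_self r
  rw [sum_morphismTerm_LInfty hf hham, row_bar_succ]
  simp only [momentumComponents, ceDiff_smul, AlternatingMap.smul_apply, map_smul,
    momentumSign_succ]
  generalize momentumSign r = ε at hsq ⊢
  generalize ceDiff (row ν r) a = x
  generalize dTot (row ν (r + 1) a) = y
  generalize contractionTot ρ (r + 1) (incl A (n + 1) ω₀) a = z
  have hε : ε ≠ 0 := left_ne_zero_of_mul_eq_one hsq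
  constructor <;> intro h
  · refine smul_right_injective (M := Omega A) hε ?_
    linear_combination (norm := module) -h
  · linear_combination (norm := module) -ε • h

theorem isHamVF_row_one_of_dBar_eq_bar (hν : ν 0 = 0) (h : dBar ν = bar ρ ω₀) (a : 𝔤) :
    IsHamVF ω₀ (row ν 1 fun _ => a) (ρ a) := by
  have h0 : (0 : Omega A) + (-1 : ℝ) ^ 1 • dTot (row ν 1 fun _ => a) =
      (-1 : ℝ) ^ 0 • interior (ρ a) (incl A (n + 1) ω₀) :=
    DFunLike.congr_fun ((dBar_eq_iff hν (bar_apply_zero ρ ω₀)).1 h 0) fun _ => a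
  change interior (ρ a) (incl A (n + 1) ω₀) = -dTot (row ν 1 fun _ => a)
  linear_combination (norm := module) -h0

theorem momentumComponents_mem_LInftyPart (hν : ν ∈ totalDegree A 𝔤 n)
    (hham : ∀ a, IsHamVF ω₀ (row ν 1 fun _ => a) (ρ a)) {i : ℕ} (hi : 1 ≤ i)
    (a : Fin i → 𝔤) : momentumComponents ν i a ∈ LInftyPart ω₀ (1 - (i : ℤ)) := by
  rw [momentumComponents, AlternatingMap.smul_apply]
  refine Submodule.smul_mem _ _ ⟨fun q hq => ?_, fun h0 => ?_⟩
  · change ν i q a = 0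
    rw [hν i q (by omega)]
    rfl
  · obtain rfl : i = 1 := by omega
    rw [apply_of_eq_one rfl a 0]
    exact ⟨ρ (a 0), hham (a 0)⟩

theorem isPremultisymplectic_of_isHamVF (hω : extD ω₀ = 0) {α : 𝔤 → Omega A}
    (h : ∀ a, IsHamVF ω₀ (α a) (ρ a)) : IsPremultisymplectic ω₀ ρ :=
  (isPremultisymplectic_iff_dTot_interior_eq_zero hω).2 fun a => by
    rw [show interior (ρ a) (incl A (n + 1) ω₀) = -dTot (α a) from h a, map_neg, dTot_dTot,
      neg_zero]

theorem mem_totalDegree_of_momentumComponents_mem (hzero : momentumComponents ν 0 = 0)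
    (hdegree : ∀ i : ℕ, 1 ≤ i → ∀ a, momentumComponents ν i a ∈ LInftyPart ω₀ (1 - (i : ℤ))) :
    ν ∈ totalDegree A 𝔤 n := by
  intro p q hpq
  suffices h : ∀ a, momentumComponents ν p a q = 0 by
    ext1 a
    change row ν p a q = 0
    rw [row_eq_momentumSign_smul, AlternatingMap.smul_apply, Pi.smul_apply, h, smul_zero]
  intro a
  rcases Nat.eq_zero_or_pos p with rfl | hp
  · rw [hzero]
    rfl
  · exact (hdegree p hp a).1 q (by omega)

theorem isHomotopyMomentumMap_momentumComponents_iff (hω : extD ω₀ = 0) :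
    IsHomotopyMomentumMap ω₀ ρ (momentumComponents ν) ↔
      ν ∈ totalDegree A 𝔤 n ∧ dBar ν = bar ρ ω₀ := by
  constructor
  · rintro ⟨-, ⟨hzero, hdegree, hrelation⟩, hham⟩
    have hν := mem_totalDegree_of_momentumComponents_mem hzero hdegree
    refine ⟨hν, (dBar_eq_iff (apply_zero_of_mem_totalDegree hν) (bar_apply_zero ρ ω₀)).2
      fun r => AlternatingMap.ext fun a => ?_⟩
    exact (relation_momentumComponents_iff hdegree hham r a).1 (hrelation r a)
  · rintro ⟨hν, h⟩
    have hν0 := apply_zero_of_mem_totalDegree hν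
    have hrow := isHamVF_row_one_of_dBar_eq_bar hν0 h
    have hham : ∀ a, IsHamVF ω₀ (momentumComponents ν 1 fun _ => a) (ρ a) := by
      rwa [momentumComponents_one]
    have hdegree (i : ℕ) (hi : 1 ≤ i) := momentumComponents_mem_LInftyPart hν hrow hi
    have hzero : momentumComponents ν 0 = 0 := by
      rw [momentumComponents, row, hν0]
      exact smul_zero _
    refine ⟨isPremultisymplectic_of_isHamVF hω hrow, ⟨hzero, hdegree, fun r a => ?_⟩, hham⟩
    exact (relation_momentumComponents_iff hdegree hham r a).2
      (DFunLike.congr_fun ((dBar_eq_iff hν0 (bar_apply_zero ρ ω₀)).1 h r) a)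

theorem isHamiltonian_iff_exists_dBar_eq_bar (hω : extD ω₀ = 0) :
    IsHamiltonian ω₀ ρ ↔ ∃ ν ∈ totalDegree A 𝔤 n, dBar ν = bar ρ ω₀ :=
  momentumComponents_surjective.exists.trans
    (exists_congr fun _ => isHomotopyMomentumMap_momentumComponents_iff hω)

end MomentumMaps

end Multisymp

end

open Multisymp in
theorem mainTheorem4_general {A : Type*} [CommRing A] [Algebra ℝ A]
    {𝔤 : Type*} [LieRing 𝔤] [LieAlgebra ℝ 𝔤] {n : ℕ} (ω₀ : Form A (n + 1)) (hω : extD ω₀ = 0)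
    (ρ : 𝔤 →ₗ⁅ℝ⁆ VF A) :
    (IsPremultisymplectic ω₀ ρ ↔ dBar (bar ρ ω₀) = 0) ∧
    (IsHamiltonian ω₀ ρ ↔ ∃ ν ∈ totalDegree A 𝔤 n, dBar ν = bar ρ ω₀) ∧
    (∀ ν ∈ totalDegree A 𝔤 n, dBar ν = bar ρ ω₀ →
      IsHomotopyMomentumMap ω₀ ρ (fun i => (-(-1 : ℝ) ^ (i * (i + 1) / 2)) •
        (incl A (n - i)).compAlternatingMap (ν i (n - i)))) := by
  refine ⟨isPremultisymplectic_iff_dBar_bar_eq_zero hω,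
    isHamiltonian_iff_exists_dBar_eq_bar hω, fun ν hν h => ?_⟩
  rw [← momentumComponents_eq_smul_compAlternatingMap hν]
  exact (isHomotopyMomentumMap_momentumComponents_iff hω).2 ⟨hν, h⟩

theorem mainTheorem4 {d : ℕ} {X : Type*} [TopologicalSpace X]
    [ChartedSpace (EuclideanSpace ℝ (Fin d)) X] [IsManifold (𝓡 d) ∞ X]
    [T2Space X] [SecondCountableTopology X]
    {𝔤 : Type*} [LieRing 𝔤] [LieAlgebra ℝ 𝔤]
    {n : ℕ} (hn : 1 ≤ n)
    (ω₀ : Multisymp.Form C^∞⟮𝓡 d, X; ℝ⟯ (n + 1)) (hω : Multisymp.extD ω₀ = 0)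
    (ρ : 𝔤 →ₗ⁅ℝ⁆ Multisymp.VF C^∞⟮𝓡 d, X; ℝ⟯) :
    (Multisymp.IsPremultisymplectic ω₀ ρ ↔ Multisymp.dBar (Multisymp.bar ρ ω₀) = 0) ∧
    (Multisymp.IsHamiltonian ω₀ ρ ↔
      ∃ ν ∈ Multisymp.totalDegree C^∞⟮𝓡 d, X; ℝ⟯ 𝔤 n,
        Multisymp.dBar ν = Multisymp.bar ρ ω₀) ∧
    (∀ ν ∈ Multisymp.totalDegree C^∞⟮𝓡 d, X; ℝ⟯ 𝔤 n,
      Multisymp.dBar ν = Multisymp.bar ρ ω₀ →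
        Multisymp.IsHomotopyMomentumMap ω₀ ρ (fun i =>
          (-(-1 : ℝ) ^ (i * (i + 1) / 2)) •
            (Multisymp.incl C^∞⟮𝓡 d, X; ℝ⟯ (n - i)).compAlternatingMap (ν i (n - i)))) :=
  mainTheorem4_general ω₀ hω ρ
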